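/- Let $n\ge 0$. For $0\le\epsilon\le 1/2$ let $X$ be uniform on $\{0,1\}^n$, and let $Y$ be obtained from $X$ by flipping each bit independently with probability $\epsilon$. For a Boolean function $f:\{0,1\}^n\to\{0,1\}$ let $I(X;f(Y))$ be the mutual information of $X$ and $f(Y)$, let $\mathbb{E}f=\mathbb{E}f(X)$, and let $W_1(f)=\sum_{i=1}^n\hat f(\{i\})^2$ with $\hat f(\{i\})=\mathbb{E}\big[f(X)(-1)^{X_i}\big]$ be its degree-1 Fourier weight. Call $f$ lexicographic if its support consists of the first $k$ or of the last $k$ strings of $\{0,1\}^n$ in the lexicographic order, for some $k$. Call $f$ balanced if $\mathbb{P}(f(X)=0)=\mathbb{P}(f(X)=1)$. There is $\epsilon_0=\epsilon_0(n)\in(0,1/2]$ such that the following holds. (1) Let $m$ be the mean of some Boolean function on $\{0,1\}^n$, and let $\mathcal F_m=\{f:\mathbb{E}f=m\}$. (a) (Weak noise.) $\mathcal F_m$ contains a lexicographic function, and for all $\epsilon\in[0,\epsilon_0]$ every lexicographic function in $\mathcal F_m$ maximizes $I(X;f(Y))$ over $f\in\mathcal F_m$. (b) (Strong noise.) Some $f\in\mathcal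 F_m$ with the largest degree-1 Fourier weight in $\mathcal F_m$ maximizes $I(X;f(Y))$ over $\mathcal F_m$ for all $\epsilon\in[1/2-\epsilon_0,1/2]$. Moreover, for all $\epsilon\in[1/2-\epsilon_0,1/2)$, every maximizer of $I(X;f(Y))$ over $\mathcal F_m$ has the largest degree-1 Fourier weight in $\mathcal F_m$. (2) For every $i\in\{1,\dots,n\}$ the dictator function $x\mapsto x_i$ is balanced, and it maximizes $I(X;f(Y))$ among all balanced Boolean functions for all $\epsilon\in[0,\epsilon_0]\cup[1/2-\epsilon_0,1/2]$. -/

import Mathlib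

namespace BooleanInfo

open Finset

/-- Boolean functions on the discrete cube `{0,1}ⁿ` (`true` is `1`, `false` is `0`). -/
abbrev BoolFun (n : ℕ) : Type := (Fin n → Bool) → Bool

/-- The mean `𝔼 f` of a Boolean function under the uniform measure on the cube. -/
noncomputable def mean {n : ℕ} (f : BoolFun n) : ℝ :=
  (∑ x : Fin n → Bool, if f x = true then (1 : ℝ) else 0) / 2 ^ n

/-- `f` is balanced: `ℙ(f = 0) = ℙ(f = 1)` under the uniform measure. -/
def IsBalanced {n : ℕ} (f : BoolFun n) : Prop :=
  #{x : Fin n → Bool | f x = false} = #{x : Fin n → Bool | f x = true}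

/-- Transition probabilities of the memoryless binary symmetric channel with crossover
probability `ε`: each bit of the input `x` is flipped independently with probability `ε`. -/
noncomputable def bscProb {n : ℕ} (ε : ℝ) (x y : Fin n → Bool) : ℝ :=
  ∏ i, if y i = x i then 1 - ε else ε

/-- The joint law of `(X, f(Y))`, where `X` is uniform on the cube and `Y` is the output of `X`
through the channel: `ℙ(X = x, f(Y) = b)`. -/
noncomputable def jointLaw {n : ℕ} (ε : ℝ) (f : BoolFun n) (x : Fin n → Bool) (b : Bool) : ℝ :=
  ∑ y : Fin n → Bool, if f y = b then (1 / 2 ^ n) * bscProb ε x y else 0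

/-- The mutual information (in nats) of two finitely valued random variables with joint law `p`,
`∑ p(a,b) log (p(a,b) / (p(a) p(b)))`. Terms with `p(a,b) = 0` vanish. -/
noncomputable def mutualInfo {α β : Type*} [Fintype α] [Fintype β] (p : α → β → ℝ) : ℝ :=
  ∑ a, ∑ b, p a b * Real.log (p a b / ((∑ b', p a b') * (∑ a', p a' b)))

/-- The mutual information `I(X; f(Y))` over the binary symmetric channel. -/
noncomputable def bscInfo {n : ℕ} (ε : ℝ) (f : BoolFun n) : ℝ :=
  mutualInfo (jointLaw ε f)

/-- The character `W_A(x) = (-1) ^ (∑_{i ∈ A} x_i)`. -/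
def walsh {n : ℕ} (A : Finset (Fin n)) (x : Fin n → Bool) : ℝ :=
  (-1) ^ (∑ i ∈ A, (x i).toNat)

/-- The Fourier coefficient `𝔼 (f W_A)`. -/
noncomputable def fourierCoeff {n : ℕ} (f : BoolFun n) (A : Finset (Fin n)) : ℝ :=
  (∑ x : Fin n → Bool, (if f x = true then (1 : ℝ) else 0) * walsh A x) / 2 ^ n

/-- The degree-1 Fourier weight. -/
noncomputable def degreeOneWeight {n : ℕ} (f : BoolFun n) : ℝ :=
  ∑ i : Fin n, fourierCoeff f {i} ^ 2

/-- `f` is lexicographic: its support is an initial or a final segment of the cube in the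
lexicographic order (first coordinate most significant), that is, the elements of the support
are selected in lexicographic order starting from `0⋯0` or starting from `1⋯1`. -/
def IsLexicographic {n : ℕ} (f : BoolFun n) : Prop :=
  IsLowerSet {x : Lex (Fin n → Bool) | f (ofLex x) = true} ∨
    IsUpperSet {x : Lex (Fin n → Bool) | f (ofLex x) = true}

/-- The dictator function of the `i`-th bit. -/
def dictator {n : ℕ} (i : Fin n) : BoolFun n := fun x => x i

end BooleanInfo

/-! Since I(X; f(Y)) = h(𝔼f) - 2⁻ⁿ ∑ₓ h(ℙ(f(Y) = 1 | X = x)), with h the binary entropy, maximizing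
information at fixed mean is minimizing `condEnt`. There are finitely many Boolean functions, so it
suffices to compare them pairwise near each end of the noise range.

Weak noise: `condEnt` is asymptotic to `boundary f` times -ε log ε (`tendsto_condEnt_div`), so a
smaller edge boundary wins. Lexicographic functions attain equality in the edge-isoperimetric
inequality (`boundary_add_ge`). First-order ties are harmless: any two extremal functions of equal
weight differ by an isometry of the cube (`Tight.cubeEquiv`), hence have the same `condEnt` at every
ε.

Strong noise: at ε = 1/2 the posterior is constantly 𝔼f, and its derivative is -2 times the degree-1
part of f. A second-order expansion of h makes the entropy deficit proportional to the degree-1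
weight (`tendsto_condEnt_half`), so a larger weight wins strictly. For ties, `condEnt` is analytic
at 1/2 when f is not constant, so every pairwise difference has a constant sign just left of 1/2 and
some function is eventually optimal.

Dictators are extremal at weak noise. Their degree-1 weight 1/4 is the largest possible, and any
function attaining it has exactly the same `condEnt` (`condEnt_eq_of_degreeOneWeight_eq`). -/

namespace BooleanInfo

open Finset

variable {n : ℕ}

/-! ### Extremal edge counts -/

/-- The largest number of edges spanned by `k` vertices of a discrete cube. -/
def edgeMax : ℕ → ℕ
  | 0 => 0
  | 1 => 0
  | k + 2 => edgeMax ((k + 2) / 2) + edgeMax ((k + 3) / 2) + (k + 2) / 2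

@[simp] lemma edgeMax_zero : edgeMax 0 = 0 := by simp [edgeMax]

@[simp] lemma edgeMax_one : edgeMax 1 = 0 := by simp [edgeMax]

lemma edgeMax_even (k : ℕ) : edgeMax (2 * k) = 2 * edgeMax k + k := by
  rcases k with _ | k
  · simp
  · rw [show 2 * (k + 1) = 2 * k + 2 by ring, edgeMax,
      show (2 * k + 2) / 2 = k + 1 by omega, show (2 * k + 3) / 2 = k + 1 by omega]
    ring

lemma edgeMax_odd (k : ℕ) : edgeMax (2 * k + 1) = edgeMax k + edgeMax (k + 1) + k := by
  rcases k with _ | k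
  · simp
  · rw [show 2 * (k + 1) + 1 = (2 * k + 1) + 2 by ring, edgeMax,
      show (2 * k + 1 + 2) / 2 = k + 1 by omega, show (2 * k + 1 + 3) / 2 = k + 1 + 1 by omega]

/-- The arithmetic behind the isoperimetric induction: b is the most edges that can join two slices
of sizes b ≤ a. Halving both numbers reduces the claim to smaller sums. -/
lemma edgeMax_add_ge {a b : ℕ} (hab : b ≤ a) :
    edgeMax a + edgeMax b + b ≤ edgeMax (a + b) := by
  induction hs : a + b using Nat.strong_induction_on generalizing a b with
  | _ s ih =>
    subst hs
    rcases Nat.eq_zero_or_pos b with rfl | hb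
    · simp
    obtain ⟨p, rfl | rfl⟩ := Nat.even_or_odd' a <;> obtain ⟨q, rfl | rfl⟩ := Nat.even_or_odd' b
    · have h := ih (p + q) (by omega) (a := p) (b := q) (by omega) rfl
      rw [← mul_add]
      simp only [edgeMax_even]
      omega
    · have h := ih (p + q) (by omega) (a := p) (b := q) (by omega) rfl
      have h' := ih (p + (q + 1)) (by omega) (a := p) (b := q + 1) (by omega) rfl
      rw [show 2 * p + (2 * q + 1) = 2 * (p + q) + 1 by ring]
      simp only [edgeMax_even, edgeMax_odd]
      rw [add_assoc p q 1]
      omega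
    · have h := ih (p + q) (by omega) (a := p) (b := q) (by omega) rfl
      have h' := ih (p + 1 + q) (by omega) (a := p + 1) (b := q) (by omega) rfl
      rw [show 2 * p + 1 + 2 * q = 2 * (p + q) + 1 by ring]
      simp only [edgeMax_even, edgeMax_odd]
      rw [show p + q + 1 = p + 1 + q by ring]
      omega
    · have h := ih (p + 1 + q) (by omega) (a := p + 1) (b := q) (by omega) rfl
      rw [show 2 * p + 1 + (2 * q + 1) = 2 * (p + 1 + q) by ring]
      simp only [edgeMax_even, edgeMax_odd]
      -- The halves are paired crosswise. If p = q, the second pair must be swapped, which costs 1;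
      -- the odd remainders leave exactly that much room.
      rcases Nat.lt_or_ge q p with hqp | hqp
      · have h' := ih (p + (q + 1)) (by omega) (a := p) (b := q + 1) (by omega) rfl
        rw [show p + (q + 1) = p + 1 + q by ring] at h'
        omega
      · have h' := ih (q + 1 + p) (by omega) (a := q + 1) (b := p) (by omega) rfl
        rw [show q + 1 + p = p + 1 + q by omega] at h'
        omega

/-- Superadditivity is an equality when the larger part is a full subcube: each of the c extra
vertices has one neighbour in it. -/
lemma edgeMax_two_pow_add (s : ℕ) {c : ℕ} (hc : c ≤ 2 ^ s) :
    edgeMax (2 ^ s + c) = edgeMax (2 ^ s) + edgeMax c + c := by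
  induction s generalizing c with
  | zero =>
    have : edgeMax 2 = 1 := by simpa using edgeMax_even 1
    interval_cases c <;> simp [this]
  | succ s ih =>
    rw [pow_succ'] at hc ⊢
    obtain ⟨d, rfl | rfl⟩ := Nat.even_or_odd' c
    · have h := ih (c := d) (by omega)
      rw [← mul_add]
      simp only [edgeMax_even]
      omega
    · have h := ih (c := d) (by omega)
      have h' := ih (c := d + 1) (by omega)
      rw [← add_assoc, ← mul_add]
      simp only [edgeMax_even, edgeMax_odd]
      rw [add_assoc (2 ^ s) d 1]
      omega

/-! ### Boundaries of Boolean functions -/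

/-- The size of the support. -/
def weight (f : BoolFun n) : ℕ := #{x | f x = true}

/-- The number of ordered pairs of neighbours at which `f` differs. -/
def boundary (f : BoolFun n) : ℕ :=
  ∑ x : Fin n → Bool, ∑ y : Fin n → Bool, if hammingDist x y = 1 ∧ f x ≠ f y then 1 else 0

/-- The complementary function. -/
def compl (f : BoolFun n) : BoolFun n := fun x => !f x

/-- The restriction to a half cube of the first direction. -/
def slice (f : BoolFun (n + 1)) (c : Bool) : BoolFun n := fun x => f (Fin.cons c x)

lemma sum_cube_succ {M : Type*} [AddCommMonoid M] (F : (Fin (n + 1) → Bool) → M) (c : Bool) :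
    ∑ x, F x = ∑ x : Fin n → Bool, F (Fin.cons c x) + ∑ x : Fin n → Bool, F (Fin.cons (!c) x) := by
  rw [← (Fin.consEquiv (fun _ : Fin (n + 1) => Bool)).sum_comp, Fintype.sum_prod_type,
    Fintype.sum_bool]
  cases c
  · exact add_comm _ _
  · rfl

lemma hammingDist_cons (a b : Bool) (x y : Fin n → Bool) :
    hammingDist (Fin.cons a x : Fin (n + 1) → Bool) (Fin.cons b y) =
      (if a = b then 0 else 1) + hammingDist x y := by
  simp only [hammingDist, card_filter, Fin.sum_univ_succ, Fin.cons_zero, Fin.cons_succ]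
  cases a <;> cases b <;> rfl

lemma weight_eq_sum (f : BoolFun n) : weight f = ∑ x, if f x = true then 1 else 0 := by
  simp [weight]

lemma weight_le (f : BoolFun n) : weight f ≤ 2 ^ n := by
  simpa [weight] using card_filter_le (univ : Finset (Fin n → Bool)) (fun x => f x = true)

lemma weight_compl (f : BoolFun n) : weight f + weight (compl f) = 2 ^ n := by
  have h := card_filter_add_card_filter_not (s := (univ : Finset (Fin n → Bool)))
    (fun x => f x = true)
  simpa [weight, compl] using h

lemma boundary_compl (f : BoolFun n) : boundary (compl f) = boundary f := by
  have h : ∀ x y, compl f x ≠ compl f y ↔ f x ≠ f y := fun x y => by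
    unfold compl
    cases f x <;> cases f y <;> decide
  simp only [boundary, h]

@[simp] lemma compl_compl_eq (f : BoolFun n) : compl (compl f) = f := by
  funext x; simp [compl]

lemma weight_succ (f : BoolFun (n + 1)) (c : Bool) :
    weight f = weight (slice f c) + weight (slice f (!c)) := by
  simp only [weight_eq_sum, slice]
  exact sum_cube_succ _ c

lemma boundary_succ (f : BoolFun (n + 1)) (c : Bool) :
    boundary f = boundary (slice f c) + boundary (slice f (!c)) +
      2 * #{x | slice f c x ≠ slice f (!c) x} := by
  have key : ∀ a b, (∑ x : Fin n → Bool, ∑ y : Fin n → Bool,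
      if 1 + hammingDist x y = 1 ∧ f (Fin.cons a x) ≠ f (Fin.cons b y) then 1 else 0) =
        #{x | slice f a x ≠ slice f b x} := by
    intro a b
    rw [card_filter]
    refine sum_congr rfl fun x _ => ?_
    rw [sum_eq_single x]
    · cases h : f (Fin.cons a x) <;> cases h' : f (Fin.cons b x) <;> simp [slice, h, h']
    · intro y _ hy
      have : hammingDist x y ≠ 0 := hammingDist_ne_zero.2 (Ne.symm hy)
      simp [this]
    · simp
  have h1 : (if c = !c then 0 else 1) = 1 := by cases c <;> rfl
  have h2 : (if (!c) = c then 0 else 1) = 1 := by cases c <;> rfl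
  have h3 : #{x | slice f (!c) x ≠ slice f c x} = #{x | slice f c x ≠ slice f (!c) x} :=
    congrArg card (filter_congr fun _ _ => ne_comm)
  generalize hN : #{x | slice f c x ≠ slice f (!c) x} = N at h3 ⊢
  have hb : ∀ a, (∑ x : Fin n → Bool, ∑ y : Fin n → Bool,
      if hammingDist x y = 1 ∧ f (Fin.cons a x) ≠ f (Fin.cons a y) then 1 else 0) =
        boundary (slice f a) := fun _ => rfl
  rw [boundary, sum_cube_succ _ c]
  simp only [sum_cube_succ (n := n) (fun y => if _ ∧ f _ ≠ f y then 1 else 0) c, sum_add_distrib,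
    hammingDist_cons, if_true, h1, h2, zero_add, key, h3, hN, hb]
  ring

/-- The excess over the trivial bound `weight f - weight g` measures the failure of nesting, so
equality forces nested slices. -/
lemma card_ne_add_weight (f g : BoolFun n) :
    #{x | f x ≠ g x} + weight g = weight f + 2 * #{x | g x = true ∧ f x = false} := by
  simp only [weight, card_filter, mul_sum, ← sum_add_distrib]
  refine sum_congr rfl fun x _ => ?_
  cases f x <;> cases g x <;> rfl

/-- Edge-isoperimetric inequality on the discrete cube. -/
theorem boundary_add_ge (f : BoolFun n) :
    2 * n * weight f ≤ boundary f + 4 * edgeMax (weight f) := by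
  -- Counting degrees, `n * weight f` counts boundary edges once and inner edges twice. As
  -- `boundary` counts ordered pairs, everything is doubled, whence the factors 2 and 4.
  induction n with
  | zero => simp
  | succ n ih =>
    obtain ⟨c, hc⟩ : ∃ c, weight (slice f (!c)) ≤ weight (slice f c) := by
      rcases le_total (weight (slice f true)) (weight (slice f false)) with h | h
      · exact ⟨false, h⟩
      · exact ⟨true, h⟩
    have h1 := ih (slice f c)
    have h2 := ih (slice f (!c))
    have h3 := card_ne_add_weight (slice f c) (slice f (!c))
    have h4 := edgeMax_add_ge hc
    rw [boundary_succ f c, weight_succ f c]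
    nlinarith

/-- Equality in the edge-isoperimetric inequality. -/
def Tight (f : BoolFun n) : Prop := boundary f + 4 * edgeMax (weight f) = 2 * n * weight f

/-- Equality at the top forces equality in each of the inequalities summed in the induction step. -/
lemma Tight.succ {f : BoolFun (n + 1)} (hf : Tight f) {c : Bool}
    (hc : weight (slice f (!c)) ≤ weight (slice f c)) :
    Tight (slice f c) ∧ Tight (slice f (!c)) ∧
      (∀ x, slice f (!c) x = true → slice f c x = true) ∧
      edgeMax (weight (slice f c)) + edgeMax (weight (slice f (!c))) + weight (slice f (!c)) =
        edgeMax (weight (slice f c) + weight (slice f (!c))) := by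
  have h1 := boundary_add_ge (slice f c)
  have h2 := boundary_add_ge (slice f (!c))
  have h3 := card_ne_add_weight (slice f c) (slice f (!c))
  have h4 := edgeMax_add_ge hc
  unfold Tight at hf ⊢
  rw [boundary_succ f c, weight_succ f c] at hf
  have h5 : 2 * (n + 1) * (weight (slice f c) + weight (slice f (!c))) =
    2 * n * weight (slice f c) + 2 * n * weight (slice f (!c)) +
      2 * weight (slice f c) + 2 * weight (slice f (!c)) := by ring
  rw [h5] at hf
  refine ⟨by omega, by omega, ?_, by omega⟩
  have h6 : #{x | slice f (!c) x = true ∧ slice f c x = false} = 0 := by omega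
  rw [card_eq_zero, filter_eq_empty_iff] at h6
  intro x hx
  have := h6 (mem_univ x)
  simpa [hx] using this

/-! ### Lexicographic functions -/

lemma toLex_cons_le (a : Bool) {x y : Fin n → Bool} (h : toLex x ≤ toLex y) :
    toLex (Fin.cons a x : Fin (n + 1) → Bool) ≤ toLex (Fin.cons a y) := by
  rcases h.eq_or_lt with h | ⟨i, hi, hi'⟩
  · rw [toLex_inj.1 h]
  · refine le_of_lt ⟨i.succ, fun j hj => ?_, by simpa using hi'⟩
    induction j using Fin.cases with
    | zero => rfl
    | succ j => simpa using hi j (Fin.succ_lt_succ_iff.1 hj)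

lemma toLex_cons_false_le_cons_true (x y : Fin n → Bool) :
    toLex (Fin.cons false x : Fin (n + 1) → Bool) ≤ toLex (Fin.cons true y) :=
  le_of_lt ⟨0, fun j hj => absurd hj (Fin.not_lt_zero j), by simp⟩

/-- An initial segment either fills the lower half cube and continues as an initial segment of the
upper one, or stays inside the lower half. -/
lemma tight_of_isLowerSet (f : BoolFun n)
    (hf : IsLowerSet {x : Lex (Fin n → Bool) | f (ofLex x) = true}) : Tight f := by
  induction n with
  | zero =>
    have hw := weight_le f
    have hb : boundary f = 0 := by simp [boundary]
    unfold Tight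
    rw [pow_zero] at hw
    interval_cases h : weight f <;> simp [hb]
  | succ n ih =>
    have hs : ∀ c, Tight (slice f c) := fun c => ih _ fun x y hxy hx =>
      hf (toLex_cons_le c hxy) hx
    have h0 := hs false
    have h1 := hs true
    unfold Tight at h0 h1 ⊢
    rw [boundary_succ f false, weight_succ f false, Bool.not_false]
    by_cases h : ∃ x, slice f true x = true
    · obtain ⟨x, hx⟩ := h
      have hall : ∀ y, slice f false y = true := fun y =>
        hf (toLex_cons_false_le_cons_true y x) hx
      have hw : weight (slice f false) = 2 ^ n := by simp [weight, hall]
      have hb : boundary (slice f false) = 0 := by simp [boundary, hall]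
      have hc := card_ne_add_weight (slice f false) (slice f true)
      have hz : #{x | slice f true x = true ∧ slice f false x = false} = 0 := by simp [hall]
      rw [hw, hz] at hc
      rw [hw, hb] at h0
      rw [hw, hb, edgeMax_two_pow_add n (weight_le _)]
      have h5 : 2 * (n + 1) * (2 ^ n + weight (slice f true)) =
        2 * n * 2 ^ n + 2 * n * weight (slice f true) + 2 * 2 ^ n + 2 * weight (slice f true) := by
        ring
      omega
    · have hall : ∀ y, slice f true y = false := by simpa using h
      have hw : weight (slice f true) = 0 := by simp [weight, hall]
      have hb : boundary (slice f true) = 0 := by simp [boundary, hall]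
      have hc : #{x | slice f false x ≠ slice f true x} = weight (slice f false) := by
        simp [weight, hall]
      rw [hw, hb, hc]
      have h5 : 2 * (n + 1) * weight (slice f false) =
        2 * n * weight (slice f false) + 2 * weight (slice f false) := by ring
      simp only [add_zero]
      omega

lemma exists_isLowerSet_weight {k : ℕ} (hk : k ≤ 2 ^ n) :
    ∃ f : BoolFun n, IsLowerSet {x : Lex (Fin n → Bool) | f (ofLex x) = true} ∧ weight f = k := by
  have hcard : Fintype.card (Lex (Fin n → Bool)) = 2 ^ n := by
    rw [Fintype.card_congr ofLex]; simp
  let e := Fintype.orderIsoFinOfCardEq (Lex (Fin n → Bool)) hcard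
  refine ⟨fun x => decide ((e.symm (toLex x)).val < k), fun x y hxy hx => ?_, ?_⟩
  · exact decide_eq_true (lt_of_le_of_lt (Fin.le_def.1 (e.symm.monotone hxy))
      (of_decide_eq_true hx))
  · have : weight (n := n) (fun x => decide ((e.symm (toLex x)).val < k)) =
        #{i : Fin (2 ^ n) | i.val < k} := by
      unfold weight
      refine card_equiv (toLex.trans e.symm.toEquiv) fun x => ?_
      simp
    rw [this, Fin.card_filter_val_lt]
    exact min_eq_right hk

/-- Comparison with an initial segment of the complementary weight avoids evaluating `edgeMax (2 ^ n
- k)`: complementing preserves the boundary, so minimality transfers. -/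
lemma Tight.compl {f : BoolFun n} (hf : Tight f) : Tight (compl f) := by
  obtain ⟨g, hg, hw⟩ := exists_isLowerSet_weight (weight_le (BooleanInfo.compl f))
  have hg := tight_of_isLowerSet g hg
  have h1 := weight_compl f
  have h2 := weight_compl g
  have h3 := boundary_add_ge (BooleanInfo.compl g)
  have h4 := boundary_add_ge (BooleanInfo.compl f)
  rw [boundary_compl] at h3 h4
  unfold Tight at hf hg ⊢
  rw [show weight (BooleanInfo.compl g) = weight f by omega] at h3
  rw [hw] at hg
  rw [boundary_compl]
  omega

lemma IsLexicographic.tight {f : BoolFun n} (hf : IsLexicographic f) : Tight f := by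
  rcases hf with hf | hf
  · exact tight_of_isLowerSet f hf
  · rw [← compl_compl_eq f]
    refine (tight_of_isLowerSet _ fun x y hxy hx => ?_).compl
    simp only [BooleanInfo.compl, Set.mem_ofPred_eq, Bool.not_eq_true'] at hx ⊢
    by_contra h
    have := hf hxy (by simpa using h)
    simp [hx] at this

/-! ### Uniqueness of the extremal functions up to symmetries of the cube -/

/-- Equality up to an isometry of the cube for the Hamming distance. -/
def CubeEquiv (f g : BoolFun n) : Prop :=
  ∃ e : Equiv.Perm (Fin n → Bool),
    (∀ x y, hammingDist (e x) (e y) = hammingDist x y) ∧ ∀ x, g (e x) = f x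

lemma CubeEquiv.symm {f g : BoolFun n} (h : CubeEquiv f g) : CubeEquiv g f := by
  obtain ⟨e, he, hfg⟩ := h
  exact ⟨e.symm, fun x y => by simpa using (he (e.symm x) (e.symm y)).symm,
    fun x => by simpa using (hfg (e.symm x)).symm⟩

lemma CubeEquiv.trans {f g h : BoolFun n} (h1 : CubeEquiv f g) (h2 : CubeEquiv g h) :
    CubeEquiv f h := by
  obtain ⟨e, he, hfg⟩ := h1
  obtain ⟨e', he', hgh⟩ := h2
  exact ⟨e.trans e', fun x y => by simp [he, he'], fun x => by simp [hfg, hgh]⟩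

lemma CubeEquiv.compl {f g : BoolFun n} (h : CubeEquiv f g) :
    CubeEquiv (compl f) (compl g) := by
  obtain ⟨e, he, hfg⟩ := h
  exact ⟨e, he, fun x => by simp [BooleanInfo.compl, hfg]⟩

lemma CubeEquiv.weight_eq {f g : BoolFun n} (h : CubeEquiv f g) : weight f = weight g := by
  obtain ⟨e, -, hfg⟩ := h
  exact card_equiv e fun x => by simp [hfg]

lemma CubeEquiv.boundary_eq {f g : BoolFun n} (h : CubeEquiv f g) : boundary f = boundary g := by
  obtain ⟨e, he, hfg⟩ := h
  unfold boundary
  refine Eq.trans (sum_congr rfl fun x _ => ?_) (Equiv.sum_comp e _)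
  refine Eq.trans (sum_congr rfl fun y _ => ?_) (Equiv.sum_comp e _)
  simp only [he, hfg]

lemma CubeEquiv.tight {f g : BoolFun n} (h : CubeEquiv f g) (hf : Tight f) : Tight g := by
  unfold Tight at *
  rwa [← h.boundary_eq, ← h.weight_eq]

lemma hammingDist_arrowCongr {ι : Type*} [Fintype ι] (σ : Equiv.Perm ι) (τ : Equiv.Perm Bool)
    (x y : ι → Bool) :
    hammingDist (σ.arrowCongr τ x) (σ.arrowCongr τ y) = hammingDist x y := by
  unfold hammingDist
  refine card_equiv σ.symm fun i => ?_
  simp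

/-- Every half cube can be moved to the half cube `x 0 = false`. -/
lemma CubeEquiv.exists_slice_true_eq_false {f : BoolFun (n + 1)} {i : Fin (n + 1)} {c : Bool}
    (h : ∀ x, f x = true → x i = c) :
    ∃ g, CubeEquiv g f ∧ ∀ x, slice g true x = false := by
  let τ : Equiv.Perm Bool := Function.Involutive.toPerm (fun b => xor b c) (fun b => by simp)
  let e := (Equiv.swap 0 i).arrowCongr τ
  refine ⟨fun x => f (e x), ⟨e, hammingDist_arrowCongr _ _, fun _ => rfl⟩, fun x => ?_⟩
  by_contra hx
  have := h _ (by simpa [slice] using hx)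
  simp [e, τ, Function.Involutive.toPerm] at this

lemma CubeEquiv.of_slice {f g : BoolFun (n + 1)} (h0 : CubeEquiv (slice f false) (slice g false))
    (h1 : ∀ x, slice f true x = false) (h2 : ∀ x, slice g true x = false) : CubeEquiv f g := by
  obtain ⟨e, he, hfg⟩ := h0
  let c := Fin.consEquiv (fun _ : Fin (n + 1) => Bool)
  let e' : Equiv.Perm (Fin (n + 1) → Bool) :=
    c.symm.trans (((Equiv.refl Bool).prodCongr e).trans c)
  have hc : ∀ a x, e' (Fin.cons a x) = Fin.cons a (e x) := fun a x => by
    simp [e', c, Fin.consEquiv]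
  refine ⟨e', fun x y => ?_, fun x => ?_⟩
  · induction x using Fin.consCases with | _ a x =>
    induction y using Fin.consCases with | _ b y =>
    rw [hc, hc, hammingDist_cons, hammingDist_cons, he]
  · induction x using Fin.consCases with | _ a x =>
    rw [hc]
    cases a
    · exact hfg x
    · exact (h2 (e x)).trans (h1 x).symm

lemma eq_of_weight_slice_eq_zero {f : BoolFun (n + 1)} {c : Bool}
    (h : weight (slice f (!c)) = 0) (x : Fin (n + 1) → Bool) (hx : f x = true) : x 0 = c := by
  by_contra hne
  unfold weight at h
  rw [card_eq_zero, filter_eq_empty_iff] at h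
  refine h (mem_univ (Fin.tail x)) ?_
  rw [slice, ← Bool.eq_not.2 hne, Fin.cons_self_tail, hx]

/-- The structural step of uniqueness: it lets both functions be moved into one half cube, lowering
the dimension. -/
lemma Tight.exists_half {f : BoolFun (n + 1)} (hf : Tight f) (hw : weight f ≤ 2 ^ n) :
    ∃ i c, ∀ x, f x = true → x i = c := by
  induction n with
  | zero =>
    have hsum := weight_succ f true
    rw [pow_zero] at hw
    obtain ⟨c, hc⟩ : ∃ c, weight (slice f (!c)) = 0 := by
      rcases Nat.eq_zero_or_pos (weight (slice f true)) with h | h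
      · exact ⟨false, h⟩
      · exact ⟨true, by omega⟩
    exact ⟨0, c, eq_of_weight_slice_eq_zero hc⟩
  | succ n ih =>
    obtain ⟨c, hc⟩ : ∃ c, weight (slice f (!c)) ≤ weight (slice f c) := by
      rcases le_total (weight (slice f true)) (weight (slice f false)) with h | h
      · exact ⟨false, h⟩
      · exact ⟨true, h⟩
    obtain ⟨h1, -, hsub, harith⟩ := hf.succ hc
    have hsum := weight_succ f c
    rcases Nat.eq_zero_or_pos (weight (slice f (!c))) with hb | hb
    · exact ⟨0, c, eq_of_weight_slice_eq_zero hb⟩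
    · rcases Nat.lt_or_ge (2 ^ n) (weight (slice f c)) with ha | ha
      -- Removing the common `2 ^ n` leaves `edgeMax` additive on two positive sizes, against
      -- `edgeMax_add_ge`.
      · obtain ⟨a, ha'⟩ := Nat.exists_eq_add_of_lt ha
        have hpow : 2 ^ (n + 1) = 2 * 2 ^ n := pow_succ' 2 n
        rw [ha', add_assoc (2 ^ n) a 1, edgeMax_two_pow_add n (by omega), add_assoc (2 ^ n),
          edgeMax_two_pow_add n (by omega)] at harith
        rcases le_total (weight (slice f (!c))) (a + 1) with h | h
        · have := edgeMax_add_ge h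
          omega
        · have := edgeMax_add_ge h
          rw [add_comm (weight (slice f (!c))) (a + 1)] at this
          omega
      -- The smaller slice is nested in the larger one, so the half cube found for the larger slice
      -- serves both.
      · obtain ⟨i, d, hid⟩ := ih h1 ha
        refine ⟨i.succ, d, fun x hx => ?_⟩
        have hx' : slice f (x 0) (Fin.tail x) = true := by rw [slice, Fin.cons_self_tail, hx]
        have hxc : slice f c (Fin.tail x) = true := by
          by_cases h0 : x 0 = c
          · rwa [h0] at hx'
          · rw [Bool.eq_not.2 h0] at hx'
            exact hsub _ hx'
        exact hid _ hxc

/-- Extremal functions for the edge-isoperimetric inequality are unique up to symmetries. -/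
theorem Tight.cubeEquiv {f g : BoolFun n} (hf : Tight f) (hg : Tight g)
    (hw : weight f = weight g) : CubeEquiv f g := by
  induction n with
  | zero =>
    refine ⟨Equiv.refl _, fun _ _ => rfl, fun x => ?_⟩
    have h : ∀ f : BoolFun 0, weight f = if f x = true then 1 else 0 := fun f => by
      rw [weight_eq_sum]
      exact Fintype.sum_subsingleton _ x
    rw [h, h] at hw
    cases hfx : f x <;> cases hgx : g x <;> simp_all
  | succ n ih =>
    have main : ∀ {f g : BoolFun (n + 1)}, Tight f → Tight g → weight f = weight g →
        weight f ≤ 2 ^ n → CubeEquiv f g := by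
      intro f g hf hg hw hle
      obtain ⟨i, c, hic⟩ := hf.exists_half hle
      obtain ⟨j, d, hjd⟩ := hg.exists_half (hw ▸ hle)
      obtain ⟨f', hf', hf1⟩ := CubeEquiv.exists_slice_true_eq_false hic
      obtain ⟨g', hg', hg1⟩ := CubeEquiv.exists_slice_true_eq_false hjd
      have hwf : weight (slice f' true) = 0 := by simp [weight, hf1]
      have hwg : weight (slice g' true) = 0 := by simp [weight, hg1]
      have hf2 := weight_succ f' false
      have hg2 := weight_succ g' false
      rw [Bool.not_false] at hf2 hg2
      have htf := (hf'.symm.tight hf).succ (c := false) (by simp [hwf])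
      have htg := (hg'.symm.tight hg).succ (c := false) (by simp [hwg])
      have hfw := hf'.weight_eq
      have hgw := hg'.weight_eq
      exact hf'.symm.trans ((CubeEquiv.of_slice (ih htf.1 htg.1 (by omega)) hf1 hg1).trans hg')
    -- Heavy functions fit in no half cube, but their complements do.
    rcases le_total (weight f) (2 ^ n) with h | h
    · exact main hf hg hw h
    · have h1 := weight_compl f
      have h2 := weight_compl g
      have := (main hf.compl hg.compl (by omega) (by rw [pow_succ] at h1; omega)).compl
      simpa using this

end BooleanInfo
namespace BooleanInfo

open Finset Filter Topology Real Asymptotics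

variable {n : ℕ}

/-! ### Mutual information as an entropy deficit -/

/-- The posterior probability `ℙ(f(Y) = 1 | X = x)`. -/
noncomputable def post (ε : ℝ) (f : BoolFun n) (x : Fin n → Bool) : ℝ :=
  ∑ y, if f y = true then bscProb ε x y else 0

/-- The sum over `x` of the entropies of `f(Y)` conditioned on `X = x`. -/
noncomputable def condEnt (ε : ℝ) (f : BoolFun n) : ℝ := ∑ x, binEntropy (post ε f x)

lemma bscProb_comm (ε : ℝ) (x y : Fin n → Bool) : bscProb ε x y = bscProb ε y x :=
  prod_congr rfl fun i _ => by simp only [eq_comm]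

lemma bscProb_eq_hammingDist (ε : ℝ) (x y : Fin n → Bool) :
    bscProb ε x y = (1 - ε) ^ (n - hammingDist x y) * ε ^ hammingDist x y := by
  have h := card_filter_add_card_filter_not (s := (univ : Finset (Fin n))) (fun i => y i = x i)
  rw [card_univ, Fintype.card_fin] at h
  have hd : hammingDist x y = #{i | ¬ y i = x i} := by
    simp only [hammingDist, ne_eq, eq_comm]
  rw [bscProb, prod_ite, prod_const, prod_const, hd, Nat.eq_sub_of_add_eq h]

lemma sum_mul_bscProb (ε : ℝ) (x : Fin n → Bool) (u : Fin n → Bool → ℝ) :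
    ∑ y : Fin n → Bool, (∏ i, u i (y i)) * bscProb ε x y =
      ∏ i, (u i (x i) * (1 - ε) + u i (!x i) * ε) := by
  simp only [bscProb, ← prod_mul_distrib]
  rw [← Fintype.prod_sum fun i b => u i b * if b = x i then 1 - ε else ε]
  refine prod_congr rfl fun i _ => ?_
  rw [Fintype.sum_bool]
  cases x i <;> simp [add_comm]

lemma sum_bscProb (ε : ℝ) (x : Fin n → Bool) : ∑ y, bscProb ε x y = 1 := by
  simpa using sum_mul_bscProb ε x (fun _ _ => 1)

lemma mean_eq_weight (f : BoolFun n) : mean f = weight f / 2 ^ n := by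
  simp [mean, weight]

lemma mean_eq_mean_iff {f g : BoolFun n} : mean f = mean g ↔ weight f = weight g := by
  rw [mean_eq_weight, mean_eq_weight, div_left_inj' (by positivity), Nat.cast_inj]

lemma sum_post (ε : ℝ) (f : BoolFun n) : ∑ x, post ε f x = 2 ^ n * mean f := by
  simp only [post, mean]
  rw [sum_comm, mul_div_cancel₀ _ (by positivity)]
  refine sum_congr rfl fun y _ => ?_
  split_ifs
  · rw [← sum_bscProb ε y]
    exact sum_congr rfl fun x _ => bscProb_comm ε x y
  · simp

lemma jointLaw_true (ε : ℝ) (f : BoolFun n) (x : Fin n → Bool) :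
    jointLaw ε f x true = post ε f x / 2 ^ n := by
  rw [jointLaw, post, sum_div]
  refine sum_congr rfl fun y _ => ?_
  split_ifs <;> ring

lemma jointLaw_false (ε : ℝ) (f : BoolFun n) (x : Fin n → Bool) :
    jointLaw ε f x false = (1 - post ε f x) / 2 ^ n := by
  rw [← sum_bscProb ε x, jointLaw, post, ← sum_sub_distrib, sum_div]
  refine sum_congr rfl fun y _ => ?_
  cases f y <;> simp
  ring

lemma post_eq_of_mean_eq_zero {f : BoolFun n} (hf : mean f = 0) (ε : ℝ) (x : Fin n → Bool) :
    post ε f x = 0 := by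
  have hw : weight f = 0 := by
    rw [mean_eq_weight, div_eq_zero_iff] at hf
    simpa using hf
  rw [weight, card_eq_zero, filter_eq_empty_iff] at hw
  rw [post]
  refine sum_eq_zero fun y _ => ?_
  rw [if_neg (hw (mem_univ y))]

lemma post_eq_of_mean_eq_one {f : BoolFun n} (hf : mean f = 1) (ε : ℝ) (x : Fin n → Bool) :
    post ε f x = 1 := by
  have hw : weight f = 2 ^ n := by
    rw [mean_eq_weight, div_eq_one_iff_eq (by positivity)] at hf
    exact_mod_cast hf
  have hc := weight_compl f
  rw [hw, Nat.add_eq_left, weight, card_eq_zero, filter_eq_empty_iff] at hc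
  rw [← sum_bscProb ε x]
  refine sum_congr rfl fun y _ => if_pos ?_
  simpa [compl] using hc (mem_univ y)

theorem bscInfo_eq (ε : ℝ) (f : BoolFun n) :
    bscInfo ε f = binEntropy (mean f) - condEnt ε f / 2 ^ n := by
  have hN : (2 : ℝ) ^ n ≠ 0 := by positivity
  have hrow : ∀ x, ∑ b, jointLaw ε f x b = 1 / 2 ^ n := fun x => by
    rw [Fintype.sum_bool, jointLaw_true, jointLaw_false]; ring
  have hcol1 : ∑ x, jointLaw ε f x true = mean f := by
    simp only [jointLaw_true]
    rw [← sum_div, sum_post, mul_div_cancel_left₀ _ hN]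
  have hcol0 : ∑ x, jointLaw ε f x false = 1 - mean f := by
    simp only [jointLaw_false]
    rw [← sum_div, sum_sub_distrib, sum_post]
    simp
    field_simp
  -- The side condition covers constant f, where a marginal vanishes and the logarithm cannot be
  -- split.
  have hterm : ∀ q m : ℝ, (m = 0 → q = 0) →
      q / 2 ^ n * log (q / 2 ^ n / (1 / 2 ^ n * m)) = (q * log q - q * log m) / 2 ^ n := by
    intro q m h
    by_cases hq : q = 0
    · simp [hq]
    · have hm : m ≠ 0 := fun hm => hq (h hm)
      rw [show q / 2 ^ n / (1 / 2 ^ n * m) = q / m by field_simp, log_div hq hm]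
      ring
  have hx : ∀ x, ∑ b, jointLaw ε f x b * log (jointLaw ε f x b /
      ((∑ b', jointLaw ε f x b') * ∑ a', jointLaw ε f a' b)) =
      (-binEntropy (post ε f x) - post ε f x * log (mean f) -
        (1 - post ε f x) * log (1 - mean f)) / 2 ^ n := by
    intro x
    rw [hrow, Fintype.sum_bool, hcol1, hcol0, jointLaw_true, jointLaw_false,
      hterm _ _ fun h => post_eq_of_mean_eq_zero h ε x,
      hterm _ _ fun h => by rw [post_eq_of_mean_eq_one (by linarith) ε x, sub_self]]
    simp only [binEntropy, log_inv]
    ring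
  rw [bscInfo, mutualInfo, sum_congr rfl fun x _ => hx x, ← sum_div, sum_sub_distrib,
    sum_sub_distrib, sum_neg_distrib, ← sum_mul, ← sum_mul, sum_sub_distrib, sum_post, condEnt]
  simp only [binEntropy, log_inv, sum_const, card_univ, Fintype.card_fun, Fintype.card_bool,
    Fintype.card_fin, nsmul_eq_mul, Nat.cast_pow, Nat.cast_ofNat]
  field_simp
  ring

lemma bscInfo_le_iff {f g : BoolFun n} (h : mean f = mean g) (ε : ℝ) :
    bscInfo ε f ≤ bscInfo ε g ↔ condEnt ε g ≤ condEnt ε f := by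
  rw [bscInfo_eq, bscInfo_eq, h, sub_le_sub_iff_left, div_le_div_iff_of_pos_right (by positivity)]

lemma CubeEquiv.condEnt_eq {f g : BoolFun n} (h : CubeEquiv f g) (ε : ℝ) :
    condEnt ε f = condEnt ε g := by
  obtain ⟨e, he, hfg⟩ := h
  unfold condEnt
  refine Eq.trans (sum_congr rfl fun x _ => ?_) (Equiv.sum_comp e _)
  refine congrArg binEntropy ?_
  refine Eq.trans (sum_congr rfl fun y _ => ?_) (Equiv.sum_comp e _)
  simp only [bscProb_eq_hammingDist, he, hfg]

/-! ### Weak noise -/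

/-- The conditional error probability `ℙ(f(Y) ≠ f(x) | X = x)`. -/
noncomputable def errProb (ε : ℝ) (f : BoolFun n) (x : Fin n → Bool) : ℝ :=
  ∑ y, if f x ≠ f y then bscProb ε x y else 0

/-- By the symmetry of h, posteriors near 1 are traded for error probabilities, which all tend to 0
with ε. -/
lemma binEntropy_post (ε : ℝ) (f : BoolFun n) (x : Fin n → Bool) :
    binEntropy (post ε f x) = binEntropy (errProb ε f x) := by
  cases hx : f x
  · congr 1
    refine sum_congr rfl fun y _ => ?_
    cases hy : f y <;> simp [hx]
  · rw [← binEntropy_one_sub]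
    congr 1
    rw [post, ← sum_bscProb ε x, ← sum_sub_distrib]
    refine sum_congr rfl fun y _ => ?_
    cases hy : f y <;> simp [hx]

lemma tendsto_errProb_div (f : BoolFun n) (x : Fin n → Bool) :
    Tendsto (fun ε => errProb ε f x / ε) (𝓝[>] 0)
      (𝓝 (∑ y, if hammingDist x y = 1 ∧ f x ≠ f y then (1 : ℝ) else 0)) := by
  simp only [errProb, sum_div]
  refine tendsto_finsetSum _ fun y _ => ?_
  by_cases hxy : f x = f y
  · simp [hxy]
  · have hd : hammingDist x y ≠ 0 := hammingDist_ne_zero.2 fun h => hxy (h ▸ rfl)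
    obtain ⟨d, hd⟩ := Nat.exists_eq_succ_of_ne_zero hd
    have hlim : Tendsto (fun ε : ℝ => (1 - ε) ^ (n - hammingDist x y) * ε ^ d) (𝓝[>] 0)
        (𝓝 ((1 - 0) ^ (n - hammingDist x y) * 0 ^ d)) :=
      (Continuous.tendsto (by fun_prop) 0).mono_left nhdsWithin_le_nhds
    have hval : ((1 : ℝ) - 0) ^ (n - hammingDist x y) * 0 ^ d =
        if hammingDist x y = 1 ∧ f x ≠ f y then (1 : ℝ) else 0 := by
      rcases Nat.eq_zero_or_pos d with rfl | hd0
      · simp [hd, hxy]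
      · simp [hd, hd0.ne']
    rw [hval] at hlim
    refine hlim.congr' ?_
    filter_upwards [self_mem_nhdsWithin] with ε hε
    have hε : ε ≠ 0 := ne_of_gt hε
    rw [if_pos hxy, bscProb_eq_hammingDist, hd, pow_succ]
    field_simp

/-- With q = εr, -q log q = r(-ε log ε) + ε(-r log r), and the last term is negligible. The other
half of h(q) is O(q) = O(ε), also negligible against ε log ε. -/
lemma tendsto_binEntropy_div_negMulLog {q : ℝ → ℝ} {a : ℝ}
    (hq : Tendsto (fun ε => q ε / ε) (𝓝[>] 0) (𝓝 a)) :
    Tendsto (fun ε => binEntropy (q ε) / negMulLog ε) (𝓝[>] 0) (𝓝 a) := by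
  have hlog : Tendsto (fun ε => -log ε) (𝓝[>] 0) atTop :=
    tendsto_neg_atBot_atTop.comp tendsto_log_nhdsGT_zero
  have h1 : Tendsto (fun ε => negMulLog (q ε / ε) / -log ε) (𝓝[>] 0) (𝓝 0) :=
    ((continuous_negMulLog.tendsto a).comp hq).div_atTop hlog
  have hε0 : Tendsto (fun ε : ℝ => ε) (𝓝[>] 0) (𝓝 0) := nhdsWithin_le_nhds
  have hpos : ∀ᶠ ε : ℝ in 𝓝[>] 0, 0 < ε ∧ ε < 1 := by
    filter_upwards [Ioo_mem_nhdsGT (zero_lt_one' ℝ)] with ε hε using hε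
  have hqO : q =O[𝓝[>] 0] (fun ε => ε) :=
    isBigO_of_div_tendsto_nhds
      (hpos.mono fun ε hε h => absurd h hε.1.ne') a hq
  have hq0 : Tendsto q (𝓝[>] 0) (𝓝 0) := hqO.trans_tendsto hε0
  have hder : HasDerivAt (fun t : ℝ => negMulLog (1 - t)) (-(-log (1 - 0) - 1)) 0 := by
    have h := hasDerivAt_negMulLog (x := 1 - 0) (by norm_num)
    exact (h.comp_const_sub 1 0)
  have hO : (fun t : ℝ => negMulLog (1 - t)) =O[𝓝 0] (fun t => t) := by
    simpa using hder.isBigO_sub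
  have h2 : Tendsto (fun ε => negMulLog (1 - q ε) / negMulLog ε) (𝓝[>] 0) (𝓝 0) := by
    refine IsLittleO.tendsto_div_nhds_zero
      (((hO.comp_tendsto hq0).trans hqO).trans_isLittleO ?_)
    refine (isLittleO_iff_tendsto' ?_).2 ?_
    · filter_upwards [hpos] with ε hε h
      exact absurd h (mul_pos_of_neg_of_neg (neg_neg_of_pos hε.1) (log_neg hε.1 hε.2)).ne'
    · refine (tendsto_inv_atTop_zero.comp hlog).congr' ?_
      filter_upwards [hpos] with ε hε
      have := hε.1.ne'
      have := (log_neg hε.1 hε.2).ne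
      simp only [Function.comp, negMulLog]
      field_simp
  have h3 := (hq.add h1).add h2
  rw [add_zero, add_zero] at h3
  refine h3.congr' ?_
  filter_upwards [hpos] with ε hε
  have he := hε.1.ne'
  have hl := (log_neg hε.1 hε.2).ne
  have hq' : q ε = ε * (q ε / ε) := by field_simp
  rw [binEntropy_eq_negMulLog_add_negMulLog_one_sub, add_div]
  congr 1
  conv_rhs => rw [hq', negMulLog_mul]
  rw [add_div]
  simp only [negMulLog]
  field_simp

theorem tendsto_condEnt_div (f : BoolFun n) :
    Tendsto (fun ε => condEnt ε f / negMulLog ε) (𝓝[>] 0) (𝓝 (boundary f)) := by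
  have hb : (boundary f : ℝ) =
      ∑ x, ∑ y, if hammingDist x y = 1 ∧ f x ≠ f y then (1 : ℝ) else 0 := by
    simp only [boundary, Nat.cast_sum, Nat.cast_ite, Nat.cast_one, Nat.cast_zero]
  rw [hb]
  simp only [condEnt, sum_div, binEntropy_post]
  exact tendsto_finsetSum _ fun x _ => tendsto_binEntropy_div_negMulLog (tendsto_errProb_div f x)

lemma eventually_condEnt_lt_of_boundary_lt {f g : BoolFun n} (h : boundary f < boundary g) :
    ∀ᶠ ε in 𝓝[>] 0, condEnt ε f < condEnt ε g := by
  have h' := (tendsto_condEnt_div f).eventually_lt (tendsto_condEnt_div g) (by exact_mod_cast h)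
  filter_upwards [h', Ioo_mem_nhdsGT (zero_lt_one' ℝ)] with ε hlt hε
  have hp : 0 < negMulLog ε :=
    mul_pos_of_neg_of_neg (neg_neg_of_pos hε.1) (log_neg hε.1 hε.2)
  exact (div_lt_div_iff_of_pos_right hp).1 hlt

/-- If g is tight too, an isometry gives equality at every ε; otherwise its boundary is strictly
larger and the leading term decides. -/
lemma Tight.eventually_condEnt_le {f g : BoolFun n} (hf : Tight f) (hw : weight f = weight g) :
    ∀ᶠ ε in 𝓝[>] 0, condEnt ε f ≤ condEnt ε g := by
  by_cases hg : Tight g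
  · exact Eventually.of_forall fun ε => ((hf.cubeEquiv hg hw).condEnt_eq ε).le
  · have h := boundary_add_ge g
    unfold Tight at hf hg
    rw [hw] at hf
    exact (eventually_condEnt_lt_of_boundary_lt (by omega)).mono fun ε h => h.le

lemma condEnt_zero (f : BoolFun n) : condEnt 0 f = 0 := by
  refine sum_eq_zero fun x _ => ?_
  have h : errProb 0 f x = 0 := sum_eq_zero fun y _ => by
    split_ifs with hxy
    · have hd : hammingDist x y ≠ 0 := hammingDist_ne_zero.2 fun h => hxy (h ▸ rfl)
      simp [bscProb_eq_hammingDist, hd]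
    · rfl
  rw [binEntropy_post, h, binEntropy_zero]

end BooleanInfo
namespace BooleanInfo

open Finset Filter Topology Real Asymptotics

variable {n : ℕ}

/-! ### Degree-1 characters -/

lemma walsh_singleton (i : Fin n) (x : Fin n → Bool) :
    walsh {i} x = if x i = true then -1 else 1 := by
  cases h : x i <;> simp [walsh, h]

lemma walsh_singleton_mul_self (i : Fin n) (x : Fin n → Bool) :
    walsh {i} x * walsh {i} x = 1 := by
  rw [walsh_singleton]; split_ifs <;> norm_num

/-- Flipping the `i`-th bit. -/
def flipBit (i : Fin n) : Equiv.Perm (Fin n → Bool) :=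
  Function.Involutive.toPerm (fun x => Function.update x i (!x i)) fun x => by simp

lemma flipBit_apply (i : Fin n) (x : Fin n → Bool) :
    flipBit i x = Function.update x i (!x i) := rfl

lemma walsh_flipBit_self (i : Fin n) (x : Fin n → Bool) :
    walsh {i} (flipBit i x) = -walsh {i} x := by
  rw [walsh_singleton, walsh_singleton, flipBit_apply, Function.update_self]
  cases x i <;> simp

lemma walsh_flipBit_of_ne {i j : Fin n} (h : j ≠ i) (x : Fin n → Bool) :
    walsh {j} (flipBit i x) = walsh {j} x := by
  rw [walsh_singleton, walsh_singleton, flipBit_apply, Function.update_of_ne h]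

lemma sum_walsh_singleton (i : Fin n) : ∑ x, walsh {i} x = 0 := by
  have h := Equiv.sum_comp (flipBit i) fun x => walsh {i} x
  simp only [walsh_flipBit_self, sum_neg_distrib] at h
  linarith

lemma sum_walsh_mul_walsh (i j : Fin n) :
    ∑ x, walsh {i} x * walsh {j} x = if i = j then 2 ^ n else 0 := by
  split_ifs with hij
  · subst hij
    simp [walsh_singleton_mul_self]
  · have h := Equiv.sum_comp (flipBit i) fun x => walsh {i} x * walsh {j} x
    simp only [walsh_flipBit_self, walsh_flipBit_of_ne (Ne.symm hij), neg_mul,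
      sum_neg_distrib] at h
    linarith

/-- The degree-1 part of the Fourier expansion. -/
noncomputable def linearPart (f : BoolFun n) (x : Fin n → Bool) : ℝ :=
  ∑ i, fourierCoeff f {i} * walsh {i} x

lemma sum_linearPart (f : BoolFun n) : ∑ x, linearPart f x = 0 := by
  simp only [linearPart]
  rw [sum_comm]
  simp [← mul_sum, sum_walsh_singleton]

lemma sum_linearPart_sq (f : BoolFun n) :
    ∑ x, linearPart f x ^ 2 = 2 ^ n * degreeOneWeight f := by
  simp only [linearPart, sq, sum_mul_sum, degreeOneWeight]
  rw [sum_comm, mul_sum]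
  refine sum_congr rfl fun i _ => ?_
  rw [sum_comm, sum_eq_single i]
  · have h := sum_walsh_mul_walsh i i
    rw [if_pos rfl] at h
    rw [← h, sum_mul]
    exact sum_congr rfl fun x _ => by ring
  · intro j _ hj
    have h := sum_walsh_mul_walsh i j
    rw [if_neg hj.symm] at h
    rw [← mul_zero (fourierCoeff f {i} * fourierCoeff f {j}), ← h, mul_sum]
    exact sum_congr rfl fun x _ => by ring
  · simp

lemma sum_mul_linearPart (f : BoolFun n) :
    ∑ x, (if f x = true then (1 : ℝ) else 0) * linearPart f x = 2 ^ n * degreeOneWeight f := by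
  simp only [linearPart, degreeOneWeight, mul_sum]
  rw [sum_comm]
  refine sum_congr rfl fun i _ => ?_
  have h : ∑ x, (if f x = true then (1 : ℝ) else 0) * walsh {i} x = 2 ^ n * fourierCoeff f {i} := by
    rw [fourierCoeff, mul_div_cancel₀ _ (by positivity)]
  rw [sq, mul_left_comm, ← h, mul_sum]
  exact sum_congr rfl fun x _ => by ring

lemma linearPart_eq_sum (f : BoolFun n) (x : Fin n → Bool) :
    linearPart f x = (∑ y, if f y = true then ∑ i, walsh {i} x * walsh {i} y else 0) / 2 ^ n := by
  simp only [linearPart, fourierCoeff]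
  rw [eq_div_iff (by positivity), sum_mul]
  simp only [div_mul_eq_mul_div, div_mul_cancel₀ _ (show (2 : ℝ) ^ n ≠ 0 by positivity), sum_mul]
  rw [sum_comm]
  refine sum_congr rfl fun y _ => ?_
  split_ifs
  · exact sum_congr rfl fun i _ => by ring
  · simp

/-! ### Strong noise -/

lemma bscProb_half (x y : Fin n → Bool) : bscProb (1 / 2) x y = 1 / 2 ^ n := by
  have h : ∀ i, (if y i = x i then 1 - (1 / 2 : ℝ) else 1 / 2) = 1 / 2 := fun i => by
    split_ifs <;> norm_num
  rw [bscProb, prod_congr rfl fun i _ => h i]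
  simp

lemma post_half (f : BoolFun n) (x : Fin n → Bool) : post (1 / 2) f x = mean f := by
  simp only [post, bscProb_half, mean, sum_div]
  refine sum_congr rfl fun y _ => ?_
  split_ifs <;> simp

/-- Differentiating one factor of the product yields a degree-1 character; the other n - 1 factors
equal 1/2 and give 2 / 2ⁿ. -/
lemma hasDerivAt_bscProb_half (x y : Fin n → Bool) :
    HasDerivAt (fun ε => bscProb ε x y)
      (-2 * ((∑ i, walsh {i} x * walsh {i} y) / 2 ^ n)) (1 / 2) := by
  have h : ∀ i ∈ (univ : Finset (Fin n)), HasDerivAt (fun ε : ℝ => if y i = x i then 1 - ε else ε)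
      (-(walsh {i} x * walsh {i} y)) (1 / 2) := by
    intro i _
    simp only [walsh_singleton]
    cases hx : x i <;> cases hy : y i <;> simp
    · exact (hasDerivAt_id _).const_sub 1
    · exact hasDerivAt_id _
    · exact hasDerivAt_id _
    · exact (hasDerivAt_id _).const_sub 1
  have hp := HasDerivAt.fun_finsetProd h
  refine hp.congr_deriv ?_
  have hc : ∀ i, (if y i = x i then 1 - (1 / 2 : ℝ) else 1 / 2) = 1 / 2 := fun i => by
    split_ifs <;> norm_num
  simp only [hc, prod_const, smul_eq_mul]
  rw [sum_div, mul_sum]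
  refine sum_congr rfl fun i _ => ?_
  rw [card_erase_of_mem (mem_univ i), card_univ, Fintype.card_fin]
  obtain ⟨k, rfl⟩ : ∃ k, n = k + 1 := Nat.exists_eq_succ_of_ne_zero (Fin.pos i).ne'
  rw [Nat.add_sub_cancel, pow_succ, one_div, inv_pow]
  field_simp

lemma hasDerivAt_post_half (f : BoolFun n) (x : Fin n → Bool) :
    HasDerivAt (fun ε => post ε f x) (-2 * linearPart f x) (1 / 2) := by
  have h : HasDerivAt (fun ε => post ε f x)
      (∑ y, if f y = true then -2 * ((∑ i, walsh {i} x * walsh {i} y) / 2 ^ n) else 0) (1 / 2) := by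
    unfold post
    refine HasDerivAt.fun_sum fun y _ => ?_
    split_ifs
    · exact hasDerivAt_bscProb_half x y
    · exact hasDerivAt_const _ _
  refine h.congr_deriv ?_
  rw [linearPart_eq_sum, sum_div, mul_sum]
  refine sum_congr rfl fun y _ => ?_
  split_ifs <;> simp

lemma tendsto_binEntropy_second_order {m : ℝ} (h0 : 0 < m) (h1 : m < 1) :
    Tendsto (fun p => (binEntropy m + (log (1 - m) - log m) * (p - m) - binEntropy p) / (p - m) ^ 2)
      (𝓝[≠] m) (𝓝 (1 / (2 * (m * (1 - m))))) := by
  have hev : ∀ᶠ p in 𝓝[≠] m, p ∈ Set.Ioo (0 : ℝ) 1 :=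
    nhdsWithin_le_nhds (Ioo_mem_nhds h0 h1)
  have hlog : HasDerivAt (fun p => log (1 - p) - log p) (-(1 - m)⁻¹ - m⁻¹) m := by
    have ha := ((hasDerivAt_log (x := 1 - m) (by linarith)).comp_const_sub 1 m)
    exact ha.sub (hasDerivAt_log h0.ne')
  refine HasDerivAt.lhopital_zero_nhdsNE
    (f' := fun p => (log (1 - m) - log m) - (log (1 - p) - log p)) (g' := fun p => 2 * (p - m))
    ?_ ?_ ?_ ?_ ?_ ?_
  · filter_upwards [hev] with p hp
    have hb := hasDerivAt_binEntropy hp.1.ne' hp.2.ne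
    have hl : HasDerivAt (fun p => binEntropy m + (log (1 - m) - log m) * (p - m))
        (log (1 - m) - log m) p := by
      simpa using (((hasDerivAt_id p).sub_const m).const_mul (log (1 - m) - log m)).const_add
        (binEntropy m)
    exact hl.sub hb
  · refine Eventually.of_forall fun p => ?_
    simpa using ((hasDerivAt_id p).sub_const m).fun_pow 2
  · filter_upwards [self_mem_nhdsWithin] with p hp
    exact mul_ne_zero two_ne_zero (sub_ne_zero.2 hp)
  · refine tendsto_nhdsWithin_of_tendsto_nhds (Continuous.tendsto' ?_ _ _ (by simp))
    fun_prop
  · exact tendsto_nhdsWithin_of_tendsto_nhds (Continuous.tendsto' (by fun_prop) _ _ (by simp))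
  -- After one use of l'Hôpital the quotient is -1/2 times a difference quotient of h', so the limit
  -- is -h''(m)/2.
  · have hs := (hasDerivAt_iff_tendsto_slope.1 hlog).const_mul (-1 / 2)
    have hv : -1 / 2 * (-(1 - m)⁻¹ - m⁻¹) = 1 / (2 * (m * (1 - m))) := by
      have : 1 - m ≠ 0 := by linarith
      field_simp
      ring
    rw [hv] at hs
    refine hs.congr' ?_
    filter_upwards [self_mem_nhdsWithin] with p hp
    have hp : p - m ≠ 0 := sub_ne_zero.2 hp
    rw [slope_def_field]
    field_simp
    ring

lemma tendsto_binEntropy_comp {m : ℝ} (h0 : 0 < m) (h1 : m < 1) {q : ℝ → ℝ} {a d : ℝ}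
    (hqa : q a = m) (hq : HasDerivAt q d a) :
    Tendsto (fun ε => (binEntropy m + (log (1 - m) - log m) * (q ε - m) - binEntropy (q ε)) /
      (ε - a) ^ 2) (𝓝[≠] a) (𝓝 (d ^ 2 / (2 * (m * (1 - m))))) := by
  -- q may return to m arbitrarily near a, so the quotient is first extended continuously to m.
  have hψ := continuousAt_update_same.2 (tendsto_binEntropy_second_order h0 h1)
  have hqc : Tendsto q (𝓝[≠] a) (𝓝 m) := by
    rw [← hqa]
    exact hq.continuousAt.tendsto.mono_left nhdsWithin_le_nhds
  have hc := hψ.tendsto.comp hqc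
  rw [Function.update_self] at hc
  have hs := (hasDerivAt_iff_tendsto_slope.1 hq).pow 2
  have hm := hs.mul hc
  rw [mul_one_div] at hm
  refine hm.congr' ?_
  filter_upwards [self_mem_nhdsWithin] with ε hε
  have hε : ε - a ≠ 0 := sub_ne_zero.2 hε
  rw [slope_def_field, hqa, Function.comp]
  by_cases hqm : q ε = m
  · simp [hqm]
  · have : q ε - m ≠ 0 := sub_ne_zero.2 hqm
    rw [Function.update_of_ne hqm]
    field_simp

theorem tendsto_condEnt_half {f : BoolFun n} (h0 : 0 < mean f) (h1 : mean f < 1) :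
    Tendsto (fun ε => (2 ^ n * binEntropy (mean f) - condEnt ε f) / (ε - 1 / 2) ^ 2)
      (𝓝[≠] (1 / 2))
      (𝓝 (2 * 2 ^ n * degreeOneWeight f / (mean f * (1 - mean f)))) := by
  have h := tendsto_finsetSum (univ : Finset (Fin n → Bool)) fun x _ =>
    tendsto_binEntropy_comp h0 h1 (post_half f x) (hasDerivAt_post_half f x)
  have hv : ∑ x, (-2 * linearPart f x) ^ 2 / (2 * (mean f * (1 - mean f))) =
      2 * 2 ^ n * degreeOneWeight f / (mean f * (1 - mean f)) := by
    simp only [mul_pow]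
    rw [← sum_div, ← mul_sum, sum_linearPart_sq]
    have : 1 - mean f ≠ 0 := by linarith
    field_simp
  rw [hv] at h
  refine h.congr fun ε => ?_
  -- The linear terms cancel because the posteriors average to the mean at every ε.
  rw [← sum_div, sum_sub_distrib, sum_add_distrib, ← mul_sum, sum_sub_distrib, sum_post, condEnt]
  simp

lemma eventually_condEnt_lt_of_weight_lt {f g : BoolFun n} (h0 : 0 < mean f) (h1 : mean f < 1)
    (hm : mean f = mean g) (h : degreeOneWeight f < degreeOneWeight g) :
    ∀ᶠ ε in 𝓝[<] (1 / 2), condEnt ε g < condEnt ε f := by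
  have hf := tendsto_condEnt_half h0 h1
  have hg := tendsto_condEnt_half (hm ▸ h0 : 0 < mean g) (hm ▸ h1)
  rw [← hm] at hg
  have hlt := hf.eventually_lt hg (by
    have : 0 < 1 - mean f := by linarith
    gcongr)
  have hle : 𝓝[<] (1 / 2 : ℝ) ≤ 𝓝[≠] (1 / 2) := nhdsWithin_mono _ fun x hx => ne_of_lt hx
  filter_upwards [hle hlt, self_mem_nhdsWithin] with ε hε hlt
  have hp : 0 < (ε - 1 / 2) ^ 2 := by
    have : ε - 1 / 2 ≠ 0 := sub_ne_zero.2 (ne_of_lt hlt)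
    positivity
  have := (div_lt_div_iff_of_pos_right hp).1 hε
  linarith

lemma analyticAt_post (f : BoolFun n) (x : Fin n → Bool) (a : ℝ) :
    AnalyticAt ℝ (fun ε => post ε f x) a := by
  unfold post
  refine Finset.analyticAt_fun_sum _ fun y _ => ?_
  split_ifs
  · unfold bscProb
    refine Finset.analyticAt_fun_prod _ fun i _ => ?_
    split_ifs <;> fun_prop
  · fun_prop

lemma analyticAt_condEnt_half {f : BoolFun n} (h0 : 0 < mean f) (h1 : mean f < 1) :
    AnalyticAt ℝ (fun ε => condEnt ε f) (1 / 2) := by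
  unfold condEnt
  refine Finset.analyticAt_fun_sum _ fun x _ => ?_
  have hp := analyticAt_post f x (1 / 2)
  have hq : AnalyticAt ℝ (fun ε => 1 - post ε f x) (1 / 2) := analyticAt_const.sub hp
  simp only [binEntropy, log_inv]
  refine (hp.mul (hp.log ?_).neg).add (hq.mul (hq.log ?_).neg)
  · rwa [post_half]
  · rw [post_half]; linarith

/-- Unless u vanishes near a, it has no zeros just left of a, and the intermediate value theorem
forbids a sign change there. -/
lemma _root_.AnalyticAt.eventually_nonpos_or_eventually_pos {u : ℝ → ℝ} {a : ℝ}
    (hu : AnalyticAt ℝ u a) :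
    (∀ᶠ t in 𝓝[<] a, u t ≤ 0) ∨ ∀ᶠ t in 𝓝[<] a, 0 < u t := by
  rcases hu.eventually_eq_zero_or_eventually_ne_zero with h | h
  · exact Or.inl ((h.filter_mono nhdsWithin_le_nhds).mono fun t ht => le_of_eq ht)
  · have hle : 𝓝[<] a ≤ 𝓝[≠] a := nhdsWithin_mono _ fun x hx => ne_of_lt hx
    have hc : ∀ᶠ t in 𝓝[<] a, ContinuousAt u t :=
      nhdsWithin_le_nhds (hu.eventually_analyticAt.mono fun t ht => ht.continuousAt)
    obtain ⟨l, hl, hsub⟩ := (mem_nhdsLT_iff_exists_Ioo_subset).1 ((h.filter_mono hle).and hc)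
    have hmem : Set.Ioo l a ∈ 𝓝[<] a := Ioo_mem_nhdsLT hl
    by_cases hpos : ∀ t ∈ Set.Ioo l a, 0 < u t
    · exact Or.inr (mem_of_superset hmem hpos)
    · push Not at hpos
      obtain ⟨t, ht, hut⟩ := hpos
      refine Or.inl (mem_of_superset hmem fun s hs => ?_)
      by_contra hus
      have hus : 0 < u s := not_le.1 hus
      have hcont : ContinuousOn u (Set.Ioo l a) := fun r hr =>
        (hsub hr).2.continuousWithinAt
      obtain ⟨r, hr, hr0⟩ := isPreconnected_Ioo.intermediate_value ht hs hcont ⟨hut, hus.le⟩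
      exact (hsub hr).1 hr0

lemma eventually_condEnt_le_or_lt {f g : BoolFun n} (h0 : 0 < mean f) (h1 : mean f < 1)
    (hm : mean f = mean g) :
    (∀ᶠ ε in 𝓝[<] (1 / 2), condEnt ε f ≤ condEnt ε g) ∨
      ∀ᶠ ε in 𝓝[<] (1 / 2), condEnt ε g < condEnt ε f := by
  have h := ((analyticAt_condEnt_half h0 h1).sub
    (analyticAt_condEnt_half (f := g) (hm ▸ h0) (hm ▸ h1))).eventually_nonpos_or_eventually_pos
  simpa only [Pi.sub_apply, sub_nonpos, sub_pos] using h

/-- Some function of given mean is eventually optimal as the noise becomes maximal. -/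
lemma exists_eventually_condEnt_le (m : ℝ) (hm : m ∈ Set.range (mean (n := n)))
    (h0 : 0 < m) (h1 : m < 1) :
    ∃ f : BoolFun n, mean f = m ∧
      ∀ g : BoolFun n, mean g = m → ∀ᶠ ε in 𝓝[<] (1 / 2), condEnt ε f ≤ condEnt ε g := by
  -- A comparison at one ε' close enough to 1/2 decides the eventual comparison, so a minimizer at
  -- that single ε' is eventually optimal.
  have key : ∀ᶠ ε' in 𝓝[<] (1 / 2), ∀ f g : BoolFun n, mean f = m → mean g = m →
      condEnt ε' f ≤ condEnt ε' g → ∀ᶠ ε in 𝓝[<] (1 / 2), condEnt ε f ≤ condEnt ε g := by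
    rw [eventually_all]
    intro f
    rw [eventually_all]
    intro g
    by_cases hfg : mean f = m ∧ mean g = m
    · obtain ⟨hf, hg⟩ := hfg
      rcases eventually_condEnt_le_or_lt (f := f) (g := g) (hf ▸ h0) (hf ▸ h1)
        (hf.trans hg.symm) with h | h
      · exact Eventually.of_forall fun _ _ _ _ => h
      · filter_upwards [h] with ε hε _ _ hle
        exact absurd hle (not_le.2 hε)
    · exact Eventually.of_forall fun _ hf hg => absurd ⟨hf, hg⟩ hfg
  obtain ⟨ε', hε'⟩ := key.exists
  obtain ⟨f₀, hf₀⟩ := hm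
  obtain ⟨f, hf, hmin⟩ := Set.exists_min_image {f : BoolFun n | mean f = m} (condEnt ε')
    (Set.toFinite _) ⟨f₀, hf₀⟩
  exact ⟨f, hf, fun g hg => hε' f g hf hg (hmin g hg)⟩

lemma condEnt_half (f : BoolFun n) : condEnt (1 / 2) f = 2 ^ n * binEntropy (mean f) := by
  simp only [condEnt, post_half]
  simp

/-! ### Balanced functions -/

lemma isBalanced_iff {f : BoolFun n} : IsBalanced f ↔ mean f = 1 / 2 := by
  have h : #{x : Fin n → Bool | f x = false} = weight (compl f) := by simp [weight, compl]
  have hc : (weight f : ℝ) + weight (compl f) = 2 ^ n := by exact_mod_cast weight_compl f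
  rw [IsBalanced, h, mean_eq_weight, ← Nat.cast_inj (R := ℝ), div_eq_iff (by positivity), ← hc]
  change _ = (weight f : ℝ) ↔ _
  constructor <;> intro h <;> linarith

/-- Because f is 0/1-valued, (f - 1/2)² = 1/4 for any mean. Hence the weight is at most 1/4, with
equality only if f is 1/2 plus its linear part. -/
lemma sum_sub_linearPart_sq (f : BoolFun n) :
    ∑ x, ((if f x = true then (1 : ℝ) else 0) - 1 / 2 - linearPart f x) ^ 2 =
      2 ^ n * (1 / 4 - degreeOneWeight f) := by
  have h : ∀ x, ((if f x = true then (1 : ℝ) else 0) - 1 / 2 - linearPart f x) ^ 2 =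
      1 / 4 + linearPart f x - 2 * ((if f x = true then (1 : ℝ) else 0) * linearPart f x) +
        linearPart f x ^ 2 := fun x => by split_ifs <;> ring
  simp only [h]
  rw [sum_add_distrib, sum_sub_distrib, sum_add_distrib, ← mul_sum, sum_linearPart,
    sum_mul_linearPart, sum_linearPart_sq]
  simp
  ring

lemma degreeOneWeight_le (f : BoolFun n) : degreeOneWeight f ≤ 1 / 4 := by
  have h := sum_sub_linearPart_sq f
  have h' : 0 ≤ (2 : ℝ) ^ n * (1 / 4 - degreeOneWeight f) := by
    rw [← h]; exact sum_nonneg fun _ _ => sq_nonneg _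
  linarith [nonneg_of_mul_nonneg_right h' (by positivity)]

lemma sum_walsh_mul_bscProb (ε : ℝ) (i : Fin n) (x : Fin n → Bool) :
    ∑ y, walsh {i} y * bscProb ε x y = (1 - 2 * ε) * walsh {i} x := by
  have h := sum_mul_bscProb ε x
    (fun j b => if j = i then (if b = true then -1 else 1) else 1)
  simp only [prod_ite_eq', mem_univ, if_true] at h
  simp only [walsh_singleton]
  rw [h, prod_eq_single i]
  · cases x i <;> simp <;> ring
  · intro j _ hj
    simp [hj]
  · simp

/-- The channel multiplies degree-1 characters by 1 - 2ε, so for such f every posterior is ε or 1 -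
ε. -/
lemma condEnt_eq_of_degreeOneWeight_eq {f : BoolFun n}
    (hw : degreeOneWeight f = 1 / 4) (ε : ℝ) : condEnt ε f = 2 ^ n * binEntropy ε := by
  have h := sum_sub_linearPart_sq f
  rw [hw, sub_self, mul_zero, sum_eq_zero_iff_of_nonneg fun _ _ => sq_nonneg _] at h
  have hlin : ∀ x, (if f x = true then (1 : ℝ) else 0) = 1 / 2 + linearPart f x := fun x => by
    have := pow_eq_zero_iff two_ne_zero |>.1 (h x (mem_univ x))
    linarith
  have hpost : ∀ x, post ε f x = 1 / 2 + (1 - 2 * ε) * linearPart f x := by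
    intro x
    have h1 : ∀ y, (if f y = true then bscProb ε x y else 0) =
        1 / 2 * bscProb ε x y + ∑ i, fourierCoeff f {i} * (walsh {i} y * bscProb ε x y) := by
      intro y
      rw [← one_mul (bscProb ε x y), ← zero_mul (bscProb ε x y), ← ite_mul, hlin, one_mul, add_mul,
        linearPart, sum_mul]
      simp only [mul_assoc]
    rw [post, sum_congr rfl fun y _ => h1 y, sum_add_distrib, ← mul_sum, sum_bscProb, sum_comm,
      linearPart, mul_sum]
    simp only [← mul_sum, sum_walsh_mul_bscProb, mul_one]
    congr 1
    rw [mul_sum]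
    exact sum_congr rfl fun i _ => mul_left_comm _ _ _
  have hent : ∀ x, binEntropy (post ε f x) = binEntropy ε := by
    intro x
    have hx := hlin x
    rw [hpost]
    split_ifs at hx
    · rw [show linearPart f x = 1 / 2 by linarith, ← binEntropy_one_sub]
      congr 1; ring
    · rw [show linearPart f x = -(1 / 2) by linarith]
      congr 1; ring
  simp [condEnt, hent]

lemma mean_dictator (i : Fin n) : mean (dictator i) = 1 / 2 := by
  have h := sum_walsh_singleton i
  have h1 : ∀ x : Fin n → Bool, walsh {i} x =
      1 - 2 * (if dictator i x = true then (1 : ℝ) else 0) := fun x => by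
    rw [walsh_singleton, dictator]; split_ifs <;> norm_num
  simp only [h1, sum_sub_distrib, ← mul_sum] at h
  rw [mean, div_eq_iff (by positivity)]
  simp at h ⊢
  linarith

lemma degreeOneWeight_dictator (i : Fin n) : degreeOneWeight (dictator i) = 1 / 4 := by
  have h : ∀ j, fourierCoeff (dictator i) {j} = if i = j then -(1 / 2) else 0 := by
    intro j
    have h1 : ∀ x : Fin n → Bool, (if dictator i x = true then (1 : ℝ) else 0) * walsh {j} x =
        1 / 2 * walsh {j} x - 1 / 2 * (walsh {i} x * walsh {j} x) := fun x => by
      rw [walsh_singleton i, dictator]; split_ifs <;> ring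
    rw [fourierCoeff, sum_congr rfl fun x _ => h1 x, sum_sub_distrib, ← mul_sum, ← mul_sum,
      sum_walsh_singleton, sum_walsh_mul_walsh, div_eq_iff (by positivity)]
    split_ifs <;> ring
  simp only [degreeOneWeight, h]
  simp
  norm_num

lemma tight_dictator (i : Fin n) : Tight (dictator i) := by
  obtain ⟨k, rfl⟩ : ∃ k, n = k + 1 := Nat.exists_eq_succ_of_ne_zero (Fin.pos i).ne'
  have h0 : IsLexicographic (dictator (0 : Fin (k + 1))) := by
    refine Or.inr fun x y hxy hx => ?_
    have h := Pi.apply_le_of_toLex (i := 0) (x := ofLex x) (y := ofLex y) hxy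
      fun j hj => absurd hj (Fin.not_lt_zero j)
    simp only [dictator, Set.mem_ofPred_eq] at hx ⊢
    rw [hx] at h
    exact Bool.eq_true_of_true_le h
  refine CubeEquiv.tight (f := dictator 0) ⟨(Equiv.swap 0 i).arrowCongr (Equiv.refl _),
    hammingDist_arrowCongr _ _, fun x => ?_⟩ h0.tight
  simp [dictator]

lemma dictator_eventually_condEnt_le (i : Fin n) {g : BoolFun n} (hg : mean g = 1 / 2) :
    ∀ᶠ ε in 𝓝[<] (1 / 2), condEnt ε (dictator i) ≤ condEnt ε g := by
  rcases (degreeOneWeight_le g).eq_or_lt with h | h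
  · refine Eventually.of_forall fun ε => ?_
    rw [condEnt_eq_of_degreeOneWeight_eq h,
      condEnt_eq_of_degreeOneWeight_eq (degreeOneWeight_dictator i)]
  · refine (eventually_condEnt_lt_of_weight_lt ?_ ?_ (hg.trans (mean_dictator i).symm) ?_).mono
      fun ε h => h.le
    · rw [hg]; norm_num
    · rw [hg]; norm_num
    · rwa [degreeOneWeight_dictator]

end BooleanInfo
-- Constant functions, a common threshold, and the main theorem
namespace BooleanInfo

open Finset Filter Topology

variable {n : ℕ}

/-- Means 0 and 1 are excluded from the expansion at 1/2, but each belongs to a single function. -/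
lemma eq_of_mean_trivial {f g : BoolFun n} (hm : mean f = mean g)
    (h : ¬ (0 < mean f ∧ mean f < 1)) : f = g := by
  have aux : ∀ {f g : BoolFun n}, weight f = 0 → weight g = 0 → f = g := by
    intro f g hf hg
    rw [weight, card_eq_zero, filter_eq_empty_iff] at hf hg
    funext x
    rw [Bool.eq_false_of_not_eq_true (hf (mem_univ x)),
      Bool.eq_false_of_not_eq_true (hg (mem_univ x))]
  have hw := mean_eq_mean_iff.1 hm
  rw [mean_eq_weight, div_lt_one (by positivity), not_and_or, not_lt, not_lt] at h
  rcases h with h | h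
  · rw [div_le_iff₀ (by positivity), zero_mul] at h
    have hf : weight f = 0 := by exact_mod_cast le_antisymm h (Nat.cast_nonneg _)
    exact aux hf (hw ▸ hf)
  · have hf : 2 ^ n ≤ weight f := by exact_mod_cast h
    have h1 := weight_compl f
    have h2 := weight_compl g
    rw [← compl_compl_eq f, ← compl_compl_eq g,
      aux (f := compl f) (g := compl g) (by omega) (by omega)]

lemma exists_eventually_optimal {m : ℝ} (hm : m ∈ Set.range (mean (n := n))) :
    ∃ f : BoolFun n, mean f = m ∧
      ∀ g : BoolFun n, mean g = m → ∀ᶠ ε in 𝓝[<] (1 / 2), condEnt ε f ≤ condEnt ε g := by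
  by_cases h : 0 < m ∧ m < 1
  · exact exists_eventually_condEnt_le m hm h.1 h.2
  · obtain ⟨f, rfl⟩ := hm
    exact ⟨f, rfl, fun g hg => by rw [eq_of_mean_trivial hg.symm h]; simp⟩

lemma eventually_condEnt_lt {f g : BoolFun n} (hm : mean f = mean g)
    (h : degreeOneWeight f < degreeOneWeight g) :
    ∀ᶠ ε in 𝓝[<] (1 / 2), condEnt ε g < condEnt ε f := by
  by_cases ht : 0 < mean f ∧ mean f < 1
  · exact eventually_condEnt_lt_of_weight_lt ht.1 ht.2 hm h
  · rw [eq_of_mean_trivial hm ht] at h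
    exact absurd h (lt_irrefl _)

lemma exists_isLexicographic {m : ℝ} (hm : m ∈ Set.range (mean (n := n))) :
    ∃ f : BoolFun n, mean f = m ∧ IsLexicographic f := by
  obtain ⟨g, rfl⟩ := hm
  obtain ⟨f, hf, hw⟩ := exists_isLowerSet_weight (weight_le g)
  exact ⟨f, mean_eq_mean_iff.2 hw, Or.inl hf⟩

/-- Comparisons that hold eventually in the two regimes hold on a common interval. -/
lemma exists_threshold (n : ℕ) :
    ∃ ε₀ : ℝ, 0 < ε₀ ∧ ε₀ ≤ 1 / 2 ∧
      (∀ ε ∈ Set.Icc 0 ε₀, ∀ f g : BoolFun n, Tight f → mean f = mean g →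
        condEnt ε f ≤ condEnt ε g) ∧
      (∀ ε ∈ Set.Icc (1 / 2 - ε₀) (1 / 2), ∀ f g : BoolFun n, mean f = mean g →
        (∀ᶠ ε in 𝓝[<] (1 / 2), condEnt ε f ≤ condEnt ε g) → condEnt ε f ≤ condEnt ε g) ∧
      (∀ ε ∈ Set.Ico (1 / 2 - ε₀) (1 / 2), ∀ f g : BoolFun n, mean f = mean g →
        degreeOneWeight f < degreeOneWeight g → condEnt ε g < condEnt ε f) := by
  have hweak : ∀ᶠ ε in 𝓝[>] (0 : ℝ), ∀ f g : BoolFun n, Tight f → mean f = mean g →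
      condEnt ε f ≤ condEnt ε g := by
    simp only [eventually_all]
    exact fun f g hf hm => hf.eventually_condEnt_le (mean_eq_mean_iff.1 hm)
  have hstrong : ∀ᶠ ε in 𝓝[<] (1 / 2 : ℝ), ∀ f g : BoolFun n, mean f = mean g →
      ((∀ᶠ ε in 𝓝[<] (1 / 2), condEnt ε f ≤ condEnt ε g) → condEnt ε f ≤ condEnt ε g) ∧
      (degreeOneWeight f < degreeOneWeight g → condEnt ε g < condEnt ε f) := by
    simp only [eventually_all, eventually_and]
    exact fun f g hm => ⟨fun h => h, eventually_condEnt_lt hm⟩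
  obtain ⟨u, hu, hu'⟩ := mem_nhdsGT_iff_exists_Ioo_subset.1 hweak
  obtain ⟨l, hl, hl'⟩ := mem_nhdsLT_iff_exists_Ioo_subset.1 hstrong
  have hu : 0 < u := hu
  have hl : l < 1 / 2 := hl
  -- Halving keeps the intervals inside the open ones; the endpoints 0 and 1/2 are checked
  -- separately, since `condEnt` there depends at most on the mean.
  have hm1 : min (u / 2) (min ((1 / 2 - l) / 2) (1 / 2)) ≤ u / 2 := min_le_left _ _
  have hm2 : min (u / 2) (min ((1 / 2 - l) / 2) (1 / 2)) ≤ (1 / 2 - l) / 2 :=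
    (min_le_right _ _).trans (min_le_left _ _)
  have hs : ∀ ε ∈ Set.Ico (1 / 2 - min (u / 2) (min ((1 / 2 - l) / 2) (1 / 2))) (1 / 2),
      ε ∈ Set.Ioo l (1 / 2) := fun ε hε => ⟨by linarith [hε.1], hε.2⟩
  refine ⟨min (u / 2) (min ((1 / 2 - l) / 2) (1 / 2)),
    lt_min (by linarith) (lt_min (by linarith) (by norm_num)),
    (min_le_right _ _).trans (min_le_right _ _), fun ε hε f g hf hm => ?_,
    fun ε hε f g hm h => ?_, fun ε hε f g hm h => ?_⟩
  · rcases hε.1.eq_or_lt with rfl | h0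
    · rw [condEnt_zero, condEnt_zero]
    · exact hu' ⟨h0, by linarith [hε.2]⟩ f g hf hm
  · rcases hε.2.eq_or_lt with rfl | h0
    · rw [condEnt_half, condEnt_half, hm]
    · exact (hl' (hs ε ⟨hε.1, h0⟩) f g hm).1 h
  · exact (hl' (hs ε hε) f g hm).2 h

end BooleanInfo

theorem mainTheorem6 (n : ℕ) :
    ∃ ε₀ : ℝ, 0 < ε₀ ∧ ε₀ ≤ 1 / 2 ∧
      (∀ m ∈ Set.range (BooleanInfo.mean (n := n)),
        -- weak noise: lexicographic functions
        ((∃ f : BooleanInfo.BoolFun n, BooleanInfo.mean f = m ∧ BooleanInfo.IsLexicographic f) ∧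
          ∀ f : BooleanInfo.BoolFun n, BooleanInfo.mean f = m → BooleanInfo.IsLexicographic f →
            ∀ ε ∈ Set.Icc 0 ε₀,
              IsMaxOn (BooleanInfo.bscInfo ε) {g | BooleanInfo.mean g = m} f) ∧
        -- strong noise: functions with the largest degree-1 Fourier weight
        (∃ f : BooleanInfo.BoolFun n, BooleanInfo.mean f = m ∧
          IsMaxOn BooleanInfo.degreeOneWeight {g | BooleanInfo.mean g = m} f ∧
          ∀ ε ∈ Set.Icc (1 / 2 - ε₀) (1 / 2),
            IsMaxOn (BooleanInfo.bscInfo ε) {g | BooleanInfo.mean g = m} f) ∧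
        (∀ ε ∈ Set.Ico (1 / 2 - ε₀) (1 / 2), ∀ f : BooleanInfo.BoolFun n,
          BooleanInfo.mean f = m →
          IsMaxOn (BooleanInfo.bscInfo ε) {g | BooleanInfo.mean g = m} f →
          IsMaxOn BooleanInfo.degreeOneWeight {g | BooleanInfo.mean g = m} f)) ∧
      -- balanced functions: dictators, in both regimes
      (∀ i : Fin n, BooleanInfo.IsBalanced (BooleanInfo.dictator i) ∧
        ∀ ε ∈ Set.Icc 0 ε₀ ∪ Set.Icc (1 / 2 - ε₀) (1 / 2),
          IsMaxOn (BooleanInfo.bscInfo ε) {g | BooleanInfo.IsBalanced g}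
            (BooleanInfo.dictator i)) := by

  obtain ⟨ε₀, h0, h1, hweak, hstrong, hlt⟩ := BooleanInfo.exists_threshold n
  refine ⟨ε₀, h0, h1, fun m hm => ⟨⟨BooleanInfo.exists_isLexicographic hm, ?_⟩, ?_, ?_⟩,
    fun i => ⟨BooleanInfo.isBalanced_iff.2 (BooleanInfo.mean_dictator i), ?_⟩⟩
  · intro f hf hlex ε hε g hg
    have hgf : BooleanInfo.mean g = BooleanInfo.mean f := Eq.trans hg hf.symm
    exact (BooleanInfo.bscInfo_le_iff hgf ε).2 (hweak ε hε f g hlex.tight hgf.symm)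
  · obtain ⟨f, hf, hopt⟩ := BooleanInfo.exists_eventually_optimal hm
    refine ⟨f, hf, fun g hg => ?_, fun ε hε g hg => ?_⟩
    -- Maximal weight follows from eventual optimality: a heavier g would eventually beat f
    -- strictly.
    · change BooleanInfo.degreeOneWeight g ≤ BooleanInfo.degreeOneWeight f
      refine not_lt.1 fun h => ?_
      obtain ⟨ε, hle, hlt⟩ := ((hopt g hg).and
        (BooleanInfo.eventually_condEnt_lt (hf.trans (Eq.symm hg)) h)).exists
      exact not_lt.2 hle hlt
    · have hgf : BooleanInfo.mean g = BooleanInfo.mean f := Eq.trans hg hf.symm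
      exact (BooleanInfo.bscInfo_le_iff hgf ε).2 (hstrong ε hε f g hgf.symm (hopt g hg))
  · intro ε hε f hf hmax g hg
    have hgf : BooleanInfo.mean g = BooleanInfo.mean f := Eq.trans hg hf.symm
    change BooleanInfo.degreeOneWeight g ≤ BooleanInfo.degreeOneWeight f
    refine not_lt.1 fun h => ?_
    exact not_lt.2 ((BooleanInfo.bscInfo_le_iff hgf ε).1 (hmax hg)) (hlt ε hε f g hgf.symm h)
  · intro ε hε g hg
    have hg' : BooleanInfo.mean g = 1 / 2 := BooleanInfo.isBalanced_iff.1 hg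
    have hgd : BooleanInfo.mean g = BooleanInfo.mean (BooleanInfo.dictator i) :=
      hg'.trans (BooleanInfo.mean_dictator i).symm
    refine (BooleanInfo.bscInfo_le_iff hgd ε).2 ?_
    rcases hε with hε | hε
    · exact hweak ε hε _ g (BooleanInfo.tight_dictator i) hgd.symm
    · exact hstrong ε hε _ g hgd.symm (BooleanInfo.dictator_eventually_condEnt_le i hg')
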